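/- Let $V$ be a finite vertex set and let a finite directed multigraph on $V$ (loops and parallel edges allowed, orientation arbitrary) be given whose edges are resistor edges $E$ together with two port edges $p_1=ab$ (directed from $a$ to $b$) and $p_2=cd$ (directed from $c$ to $d$), where $a,b,c,d\in V$ need not be distinct. Let $K$ be a field and let $g_e\in K$ be a conductance parameter for each $e\in E$; take all resistance parameters $r_e=1$. The electrical network equations, in variables $i_1,i_2$ (port currents), $v_1,v_2$ (port voltages) and $x_e$ ($e\in E$), are Kirchhoff's current law at every vertex for the edge currents $i_1,i_2$ on the ports and $g_ex_e$ on the resistors, and Kirchhoff's voltage law for every element of the cycle space of the graph with edge set $E\cup\{p_1,p_2\}$, for the voltage drops $v_1,v_2$ on the ports and $r_ex_e=x_e$ on the resistors. Currents and voltage drops are all measured along the edge orientations; in particular $i_1$ flows through $p_1$ from $a$ to $b$, and $v_2$ is the potential at $c$ minus the potential at $d$. For $F\subseteq E$ put $g_F=\prod_{e\in F}g_e$. Let $\mathcal B$ be the collection of edge sets $T\subseteq E$ of trees that span $V$. For vertices $i,j,k,l$ let $\mathcal B_{ik,jl}$ be the collection of all $F\subseteq E$ for which $(V,F)$ is a forest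 with exactly two trees, where $i$ and $k$ are in one tree and $j$ and $l$ are in the other tree. Assume $\sum_{T\in\mathcal B}g_T\neq 0$. Then the transfer resistance $\rho_{21}$, given by $(-v_2)/i_1$ when $i_2=0$ and $i_1\neq 0$, is well defined: for every $i_1\ne 0$ the electrical network equations have a solution with this value of $i_1$ and with $i_2=0$, and $(-v_2)/i_1$ has the same value $\rho_{21}$ for all solutions with $i_1\neq0$ and $i_2=0$. Moreover \[ \rho_{21}=\frac{\sum_{F\in\mathcal B_{ac,bd}}g_F-\sum_{F\in\mathcal B_{ad,bc}}g_F}{\sum_{T\in\mathcal B}g_T}. \] -/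

import Mathlib

/-- A finite directed multigraph on the vertex set `V` with two kinds of edges: ports `P` and
resistors `E`.  Loops and parallel edges are allowed; the orientation is arbitrary. -/
structure PortedGraph (V P E : Type*) where
  /-- initial vertex of an edge -/
  tail : P ⊕ E → V
  /-- final vertex of an edge -/
  head : P ⊕ E → V

namespace PortedGraph

section Electrical

variable {V P E : Type*} [DecidableEq V] [Fintype P] [Fintype E] {K : Type*} [Field K]

/-- The oriented incidence matrix, `+1` at the tail and `-1` at the head (`0` for a loop). -/
def incidence (G : PortedGraph V P E) (K : Type*) [Field K] : Matrix V (P ⊕ E) K :=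
  Matrix.of fun u s => (if G.tail s = u then 1 else 0) - (if G.head s = u then 1 else 0)

/-- The electrical network equations with conductance parameters `g` and resistance parameters
`r`, in the port currents `i`, the port voltages `v` and the variables `x` of the resistors: the
resistor `e` carries the current `g e * x e` and has the voltage drop `r e * x e`. The current
`i p` flows through the port edge `p` from its tail to its head, and `v p` is the potential at
its tail minus the potential at its head. -/
structure IsSolution (G : PortedGraph V P E) (g r : E → K) (i v : P → K) (x : E → K) : Prop where
  /-- Kirchhoff's current law at every vertex. -/
  current : (G.incidence K).mulVec (Sum.elim i fun e => g e * x e) = 0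
  /-- Kirchhoff's voltage law around every element of the cycle space. -/
  voltage : ∀ c : P ⊕ E → K, (G.incidence K).mulVec c = 0 →
    c ⬝ᵥ (Sum.elim v fun e => r e * x e) = 0

/-- The relation between port currents and port voltages that is left when the variables of the
resistors are eliminated from the electrical network equations. -/
def PortRelation (G : PortedGraph V P E) (g r : E → K) (i v : P → K) : Prop :=
  ∃ x : E → K, G.IsSolution g r i v x

/-- For a network with two ports `0` and `1` (the first and the second port): the transfer
resistance from the first port to the second one is well defined and equals `ρ`. That is, every
nonzero current can be imposed on the first port while the current in the second port is zero,
and whenever this is done, `(-v₂) / i₁ = ρ`. -/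
def HasTransferResistance (G : PortedGraph V (Fin 2) E) (g r : E → K) (ρ : K) : Prop :=
  (∀ i : Fin 2 → K, i 0 ≠ 0 → i 1 = 0 → ∃ v, G.PortRelation g r i v) ∧
  ∀ i v : Fin 2 → K, G.PortRelation g r i v → i 0 ≠ 0 → i 1 = 0 → -(v 1) / i 0 = ρ

/-- There is at most one such value. -/
theorem HasTransferResistance.unique {G : PortedGraph V (Fin 2) E} {g r : E → K} {ρ σ : K}
    (hρ : G.HasTransferResistance g r ρ) (hσ : G.HasTransferResistance g r σ) : ρ = σ := by
  obtain ⟨v, hv⟩ := hρ.1 ![1, 0] (by simp) (by simp)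
  rw [← hρ.2 _ v hv (by simp) (by simp), ← hσ.2 _ v hv (by simp) (by simp)]

end Electrical

section Forests

variable {V P E : Type*}

/-- The unordered pair of end vertices of a resistor edge. -/
def ends (G : PortedGraph V P E) (e : E) : Sym2 V :=
  s(G.tail (Sum.inr e), G.head (Sum.inr e))

/-- The simple graph that underlies the subgraph `(V, F)`. -/
def subgraph (G : PortedGraph V P E) (F : Finset E) : SimpleGraph V :=
  SimpleGraph.fromEdgeSet (G.ends '' (F : Set E))

/-- `(V, F)` has no cycle: no loop, no two parallel edges, and no cycle of the underlying simple
graph. -/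
def IsForest (G : PortedGraph V P E) (F : Finset E) : Prop :=
  (∀ e ∈ F, ¬ (G.ends e).IsDiag) ∧ Set.InjOn G.ends (F : Set E) ∧ (G.subgraph F).IsAcyclic

/-- `(V, F)` is a tree. -/
def IsSpanningTree (G : PortedGraph V P E) (F : Finset E) : Prop :=
  G.IsForest F ∧ (G.subgraph F).Connected

/-- `(V, F)` is a forest with exactly two trees, one of which contains `i` and `k` and the other
one of which contains `j` and `l`. -/
def IsSeparatingForest (G : PortedGraph V P E) (i k j l : V) (F : Finset E) : Prop :=
  G.IsForest F ∧ Nat.card (G.subgraph F).ConnectedComponent = 2 ∧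
    (G.subgraph F).Reachable i k ∧ (G.subgraph F).Reachable j l ∧ ¬ (G.subgraph F).Reachable i j

open Classical in
/-- The edge sets of spanning trees. -/
noncomputable def spanningTrees [Fintype E] (G : PortedGraph V P E) : Finset (Finset E) :=
  Finset.univ.filter fun T => G.IsSpanningTree T

open Classical in
/-- The edge sets of spanning forests with exactly two trees that separate `i`, `k` from
`j`, `l`. -/
noncomputable def separatingForests [Fintype E] (G : PortedGraph V P E) (i k j l : V) :
    Finset (Finset E) :=
  Finset.univ.filter fun F => G.IsSeparatingForest i k j l F

end Forests

end PortedGraph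

/-! Kirchhoff's tree argument. Averaging unit currents from `a` to `b` through the spanning trees
`T`, with weights `g_T`, is the same as driving the resistors by `potential g a b`: deleting `e`
from `T` leaves a two-tree forest whose trees `e` joins, and conversely
(`sum_twoForests_eq_sum_spanningTrees`). So the potential sends the current `S = ∑ g_T` from `a` to
`b` (`sum_incidence_mul_potential`), and as `S ≠ 0`, rescaling gives existence. For the value, the
current of `potential g c d`, closed through the second port, is a cycle on which the voltage law
can be tested. Tellegen's theorem for the given currents against the same potential then expresses
`S * v₂` by `i₁` and the potential difference between `a` and `b`, a difference of two forest sums.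
-/

namespace PortedGraph

/-! ### Exchange between spanning trees and two-tree forests -/

section TreesAndForests

open Classical

variable {V P E : Type*} (G : PortedGraph V P E)

theorem mem_spanningTrees [Fintype E] {T : Finset E} :
    T ∈ G.spanningTrees ↔ G.IsSpanningTree T := by
  simp [spanningTrees]

/-- `(V, F)` is a forest with exactly two trees. -/
def IsTwoForest (F : Finset E) : Prop :=
  G.IsForest F ∧ Nat.card (G.subgraph F).ConnectedComponent = 2

theorem subgraph_adj {F : Finset E} {u w : V} :
    (G.subgraph F).Adj u w ↔ (∃ e ∈ F, G.ends e = s(u, w)) ∧ u ≠ w := by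
  simp [subgraph]

theorem subgraph_mono {F F' : Finset E} (h : F ⊆ F') : G.subgraph F ≤ G.subgraph F' :=
  SimpleGraph.fromEdgeSet_mono (Set.image_mono (by exact_mod_cast h))

theorem subgraph_insert (F : Finset E) (e : E) :
    G.subgraph (insert e F) =
      G.subgraph F ⊔ SimpleGraph.edge (G.tail (Sum.inr e)) (G.head (Sum.inr e)) := by
  rw [subgraph, Finset.coe_insert, Set.image_insert_eq, Set.insert_eq,
    SimpleGraph.fromEdgeSet_union, sup_comm]
  rfl

theorem reachable_ends_of_mem {F : Finset E} {e : E} (he : e ∈ F) :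
    (G.subgraph F).Reachable (G.tail (Sum.inr e)) (G.head (Sum.inr e)) := by
  by_cases h : G.tail (Sum.inr e) = G.head (Sum.inr e)
  · rw [h]
  · exact SimpleGraph.Adj.reachable (G.subgraph_adj.2 ⟨⟨e, he, rfl⟩, h⟩)

variable {G}

theorem IsForest.mono {F F' : Finset E} (h : F ⊆ F') (hF : G.IsForest F') : G.IsForest F :=
  ⟨fun e he => hF.1 e (h he), hF.2.1.mono (by exact_mod_cast h),
    hF.2.2.anti (G.subgraph_mono h)⟩

theorem IsForest.not_reachable_erase {T : Finset E} (hT : G.IsForest T) {e : E} (he : e ∈ T) :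
    ¬ (G.subgraph (T.erase e)).Reachable (G.tail (Sum.inr e)) (G.head (Sum.inr e)) := by
  have hne : G.tail (Sum.inr e) ≠ G.head (Sum.inr e) := by
    simpa [ends] using hT.1 e he
  have hacyc := hT.2.2
  rw [← Finset.insert_erase he, subgraph_insert, SimpleGraph.isAcyclic_sup_fromEdgeSet_iff]
    at hacyc
  intro hr
  rcases hacyc.2 hr with h | h
  · exact hne h
  -- The remaining case is an edge parallel to `e`, invisible to the simple graph; injectivity of
  -- `ends` on `T` excludes it.
  · obtain ⟨⟨f, hf, hfe⟩, -⟩ := G.subgraph_adj.1 h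
    exact (Finset.mem_erase.1 hf).1
      (hT.2.1 (Finset.mem_coe.2 (Finset.mem_erase.1 hf).2) (Finset.mem_coe.2 he) hfe)

theorem reachable_ends_erase {T : Finset E} (hT : (G.subgraph T).Connected) (e : E) (w : V) :
    (G.subgraph (T.erase e)).Reachable (G.tail (Sum.inr e)) w ∨
      (G.subgraph (T.erase e)).Reachable (G.head (Sum.inr e)) w := by
  obtain ⟨p⟩ := hT.preconnected w (G.tail (Sum.inr e))
  generalize hy : G.tail (Sum.inr e) = y at p
  induction p with
  | nil => exact Or.inl (hy ▸ SimpleGraph.Reachable.rfl)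
  | @cons x z y hadj p ih =>
    obtain ⟨⟨f, hf, hfe⟩, hne⟩ := G.subgraph_adj.1 hadj
    by_cases hef : f = e
    · subst hef
      rw [ends, Sym2.eq_iff] at hfe
      rcases hfe with ⟨h, -⟩ | ⟨-, h⟩
      · exact Or.inl (by rw [← hy, h])
      · exact Or.inr (by rw [h])
    · have hr : (G.subgraph (T.erase e)).Reachable z x :=
        SimpleGraph.Adj.reachable
          (G.subgraph_adj.2 ⟨⟨f, Finset.mem_erase.2 ⟨hef, hf⟩, by rw [hfe, Sym2.eq_swap]⟩,
            hne.symm⟩)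
      exact (ih hy).imp (fun h => h.trans hr) (fun h => h.trans hr)

theorem IsSpanningTree.isTwoForest_erase {T : Finset E} (hT : G.IsSpanningTree T) {e : E}
    (he : e ∈ T) : G.IsTwoForest (T.erase e) := by
  refine ⟨hT.1.mono (Finset.erase_subset _ _), Nat.card_eq_two_iff.2
    ⟨(G.subgraph (T.erase e)).connectedComponentMk (G.tail (Sum.inr e)),
      (G.subgraph (T.erase e)).connectedComponentMk (G.head (Sum.inr e)), ?_, ?_⟩⟩
  · intro h
    exact hT.1.not_reachable_erase he (SimpleGraph.ConnectedComponent.exact h)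
  · refine Set.eq_univ_of_forall fun C => ?_
    induction C using SimpleGraph.ConnectedComponent.ind with
    | h w =>
      rcases reachable_ends_erase hT.2 e w with h | h
      · exact Or.inl (SimpleGraph.ConnectedComponent.sound h.symm)
      · exact Or.inr (SimpleGraph.ConnectedComponent.sound h.symm)

/-- Among three vertices of a graph with two connected components, two lie in the same one. -/
theorem IsTwoForest.reachable_or {F : Finset E} (hF : G.IsTwoForest F) (x y z : V) :
    (G.subgraph F).Reachable x y ∨ (G.subgraph F).Reachable y z ∨
      (G.subgraph F).Reachable x z := by
  obtain ⟨C, D, -, hCD⟩ := Nat.card_eq_two_iff.1 hF.2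
  have key : ∀ w, (G.subgraph F).connectedComponentMk w = C ∨
      (G.subgraph F).connectedComponentMk w = D := fun w => by
    have : (G.subgraph F).connectedComponentMk w ∈ ({C, D} : Set _) := hCD ▸ Set.mem_univ _
    simpa using this
  simp only [← SimpleGraph.ConnectedComponent.eq]
  rcases key x with hx | hx <;> rcases key y with hy | hy <;> rcases key z with hz | hz <;>
    simp [hx, hy, hz]

theorem IsTwoForest.isSpanningTree_insert {F : Finset E} (hF : G.IsTwoForest F) {e : E}
    (he : ¬ (G.subgraph F).Reachable (G.tail (Sum.inr e)) (G.head (Sum.inr e))) :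
    G.IsSpanningTree (insert e F) := by
  have hne : G.tail (Sum.inr e) ≠ G.head (Sum.inr e) := fun h => he (h ▸ .rfl)
  have heF : ∀ f ∈ F, G.ends f ≠ G.ends e := fun f hf hfe =>
    he (SimpleGraph.Adj.reachable (G.subgraph_adj.2 ⟨⟨f, hf, hfe⟩, hne⟩))
  refine ⟨⟨?_, ?_, ?_⟩, ?_⟩
  · intro f hf
    rcases Finset.mem_insert.1 hf with rfl | hf
    · simpa [ends] using hne
    · exact hF.1.1 f hf
  · rw [Finset.coe_insert, Set.injOn_insert fun h => heF e h rfl]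
    refine ⟨hF.1.2.1, ?_⟩
    rintro ⟨f, hf, hfe⟩
    exact heF f hf hfe
  · rw [subgraph_insert]
    exact hF.1.2.2.sup_edge_of_not_reachable he
  · have hle := G.subgraph_mono (Finset.subset_insert e F)
    have hth := G.reachable_ends_of_mem (Finset.mem_insert_self e F)
    have key : ∀ w, (G.subgraph (insert e F)).Reachable (G.tail (Sum.inr e)) w := fun w => by
      rcases hF.reachable_or (G.tail (Sum.inr e)) (G.head (Sum.inr e)) w with h | h | h
      · exact absurd h he
      · exact hth.trans (h.mono hle)
      · exact h.mono hle
    exact (SimpleGraph.connected_iff_exists_forall_reachable _).2 ⟨_, key⟩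

end TreesAndForests

/-! ### The forest potential and its Laplacian -/

section Potential

open Classical

variable {V P E : Type*} {K : Type*} [Field K] (G : PortedGraph V P E)

/-- Indicator of reachability in `(V, F)`. -/
noncomputable def connects (K : Type*) [Field K] (F : Finset E) (u w : V) : K :=
  if (G.subgraph F).Reachable u w then 1 else 0

/-- The edge sets of spanning forests with exactly two trees. -/
noncomputable def twoForests [Fintype E] : Finset (Finset E) :=
  Finset.univ.filter fun F => G.IsTwoForest F

/-- The sum of the weights of the forests with two trees, one of which contains `a` and `w` and
the other one `b`. -/
noncomputable def potential [Fintype E] (g : E → K) (a b w : V) : K :=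
  ∑ F ∈ G.twoForests,
    if (G.subgraph F).Reachable a b then 0 else (∏ e ∈ F, g e) * G.connects K F a w

variable {G}

/-- A unit current from `a` to `b` through a spanning tree obeys the current law. -/
theorem IsSpanningTree.sum_incidence_mul_connects [DecidableEq V] {T : Finset E} (hT : G.IsSpanningTree T)
    (u a b : V) :
    ∑ e ∈ T, G.incidence K u (Sum.inr e) *
        (G.connects K (T.erase e) (G.tail (Sum.inr e)) a -
          G.connects K (T.erase e) (G.tail (Sum.inr e)) b) =
      (if a = u then 1 else 0) - (if b = u then 1 else 0) := by
  -- The difference of indicators telescopes along a walk from `a` to `b`, so adjacent vertices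
  -- suffice. If `f` joins them, deleting any other edge keeps them connected, so only `f`
  -- contributes.
  obtain ⟨p⟩ := hT.2.preconnected a b
  induction p with
  | nil => simp
  | @cons x y z hadj p ih =>
    have step : ∑ e ∈ T, G.incidence K u (Sum.inr e) *
        (G.connects K (T.erase e) (G.tail (Sum.inr e)) x -
          G.connects K (T.erase e) (G.tail (Sum.inr e)) y) =
      (if x = u then 1 else 0) - (if y = u then 1 else 0) := by
      obtain ⟨⟨f, hf, hfe⟩, hne⟩ := G.subgraph_adj.1 hadj
      rw [Finset.sum_eq_single_of_mem f hf]
      · have hnr := hT.1.not_reachable_erase hf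
        rw [ends, Sym2.eq_iff] at hfe
        rcases hfe with ⟨rfl, rfl⟩ | ⟨rfl, rfl⟩
        · simp [connects, hnr, incidence]
        · simp [connects, hnr, incidence]
      · intro e _ hef
        have hr : (G.subgraph (T.erase e)).Reachable x y :=
          SimpleGraph.Adj.reachable (G.subgraph_adj.2
            ⟨⟨f, Finset.mem_erase.2 ⟨hef.symm, hf⟩, hfe⟩, hne⟩)
        have hiff : (G.subgraph (T.erase e)).Reachable (G.tail (Sum.inr e)) x ↔
            (G.subgraph (T.erase e)).Reachable (G.tail (Sum.inr e)) y :=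
          ⟨fun h => h.trans hr, fun h => h.trans hr.symm⟩
        simp [connects, hiff]
    rw [← sub_add_sub_cancel (if x = u then (1 : K) else 0) (if y = u then 1 else 0), ← step,
      ← ih, ← Finset.sum_add_distrib]
    exact Finset.sum_congr rfl fun e _ => by ring

/-- Reciprocity: with only two trees, both sides vanish unless `F` separates `a` from `b` and `s`
from `t`. They are then `1` if `s` lies with `a` and `-1` if it lies with `b`. -/
theorem IsTwoForest.connects_sub_connects {F : Finset E} (hF : G.IsTwoForest F) (a b s t : V) :
    (if (G.subgraph F).Reachable a b then 0 else G.connects K F a s - G.connects K F a t) =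
      if (G.subgraph F).Reachable s t then 0 else G.connects K F s a - G.connects K F s b := by
  have hab := hF.reachable_or a b s
  have hst := hF.reachable_or s t a
  have htb := hF.reachable_or s t b
  have habt := hF.reachable_or a b t
  simp only [connects, ← SimpleGraph.ConnectedComponent.eq] at *
  split_ifs <;> grind

variable [Fintype E] (G)

theorem potential_sub_potential (g : E → K) (a b s t : V) :
    G.potential g a b s - G.potential g a b t =
      ∑ F ∈ G.twoForests, (∏ e ∈ F, g e) *
        if (G.subgraph F).Reachable s t then 0 else G.connects K F s a - G.connects K F s b := by
  rw [potential, potential, ← Finset.sum_sub_distrib]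
  refine Finset.sum_congr rfl fun F hF => ?_
  rw [← (Finset.mem_filter.1 hF).2.connects_sub_connects]
  split_ifs <;> ring

/-- `F ↦ insert e F` and `T ↦ T.erase e` are mutually inverse, and `g e` completes the weight of `F`
to that of `T`. -/
theorem sum_twoForests_eq_sum_spanningTrees (g : E → K) (f : Finset E → K) (e : E) :
    ∑ F ∈ G.twoForests, g e * ((∏ e ∈ F, g e) *
        if (G.subgraph F).Reachable (G.tail (Sum.inr e)) (G.head (Sum.inr e)) then 0 else f F) =
      ∑ T ∈ G.spanningTrees with e ∈ T, (∏ e ∈ T, g e) * f (T.erase e) := by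
  simp only [mul_ite, mul_zero, ← ite_not (p := SimpleGraph.Reachable _ _ _)]
  rw [← Finset.sum_filter]
  have hnot : ∀ F ∈ G.twoForests.filter fun F =>
      ¬ (G.subgraph F).Reachable (G.tail (Sum.inr e)) (G.head (Sum.inr e)), e ∉ F :=
    fun F hF he => (Finset.mem_filter.1 hF).2 (G.reachable_ends_of_mem he)
  refine Finset.sum_bij' (fun F _ => insert e F) (fun T _ => T.erase e) ?_ ?_ ?_ ?_ ?_
  · intro F hF
    obtain ⟨h₁, h₂⟩ := Finset.mem_filter.1 hF
    exact Finset.mem_filter.2 ⟨G.mem_spanningTrees.2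
      ((Finset.mem_filter.1 h₁).2.isSpanningTree_insert h₂), Finset.mem_insert_self _ _⟩
  · intro T hT
    obtain ⟨h₁, h₂⟩ := Finset.mem_filter.1 hT
    rw [mem_spanningTrees] at h₁
    exact Finset.mem_filter.2 ⟨Finset.mem_filter.2 ⟨Finset.mem_univ _, h₁.isTwoForest_erase h₂⟩,
      h₁.1.not_reachable_erase h₂⟩
  · exact fun F hF => Finset.erase_insert (hnot F hF)
  · exact fun T hT => Finset.insert_erase (Finset.mem_filter.1 hT).2
  · intro F hF
    rw [Finset.prod_insert (hnot F hF), Finset.erase_insert (hnot F hF), mul_assoc]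

/-- The Laplacian of the potential is supported on `a` and `b`. -/
theorem sum_incidence_mul_potential [DecidableEq V] (g : E → K) (a b u : V) :
    ∑ e, G.incidence K u (Sum.inr e) * (g e *
        (G.potential g a b (G.tail (Sum.inr e)) - G.potential g a b (G.head (Sum.inr e)))) =
      (∑ T ∈ G.spanningTrees, ∏ e ∈ T, g e) *
        ((if a = u then 1 else 0) - (if b = u then 1 else 0)) := by
  have key : ∀ e, g e * (G.potential g a b (G.tail (Sum.inr e)) -
      G.potential g a b (G.head (Sum.inr e))) =
      ∑ T ∈ G.spanningTrees with e ∈ T, (∏ e ∈ T, g e) *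
        (G.connects K (T.erase e) (G.tail (Sum.inr e)) a -
          G.connects K (T.erase e) (G.tail (Sum.inr e)) b) := fun e => by
    rw [potential_sub_potential, Finset.mul_sum]
    exact G.sum_twoForests_eq_sum_spanningTrees g (fun F =>
      G.connects K F (G.tail (Sum.inr e)) a - G.connects K F (G.tail (Sum.inr e)) b) e
  simp only [key, Finset.mul_sum, Finset.sum_mul]
  -- Summing over trees first isolates, for each `T`, the unit current through `T`.
  rw [Finset.sum_comm' (t' := G.spanningTrees) (s' := fun T => T)
    (by intro e T; simp [and_comm])]
  refine Finset.sum_congr rfl fun T hT => ?_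
  rw [← (G.mem_spanningTrees.1 hT).sum_incidence_mul_connects u a b, Finset.mul_sum]
  exact Finset.sum_congr rfl fun e _ => by ring

theorem sum_separatingForests (g : E → K) (i k j l : V) :
    ∑ F ∈ G.separatingForests i k j l, ∏ e ∈ F, g e =
      ∑ F ∈ G.twoForests, if (G.subgraph F).Reachable i k ∧ (G.subgraph F).Reachable j l ∧
        ¬ (G.subgraph F).Reachable i j then ∏ e ∈ F, g e else 0 := by
  rw [← Finset.sum_filter, twoForests, Finset.filter_filter]
  refine Finset.sum_congr (Finset.filter_congr fun F _ => ?_) fun _ _ => rfl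
  simp only [IsSeparatingForest, IsTwoForest, and_assoc]

/-- Only forests separating both `a` from `b` and `c` from `d` count; the sign tells whether `a`
lies with `c` or with `d`. -/
theorem potential_sub_potential_eq_separatingForests (g : E → K) (a b c d : V) :
    G.potential g c d a - G.potential g c d b =
      ∑ F ∈ G.separatingForests a c b d, ∏ e ∈ F, g e -
        ∑ F ∈ G.separatingForests a d b c, ∏ e ∈ F, g e := by
  rw [potential_sub_potential, sum_separatingForests, sum_separatingForests,
    ← Finset.sum_sub_distrib]
  refine Finset.sum_congr rfl fun F hF => ?_
  have hF' := (Finset.mem_filter.1 hF).2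
  have h₁ := hF'.reachable_or a b c
  have h₂ := hF'.reachable_or a b d
  have h₃ := hF'.reachable_or c d a
  have h₄ := hF'.reachable_or c d b
  simp only [connects, ← SimpleGraph.ConnectedComponent.eq] at *
  split_ifs <;> grind

end Potential

/-! ### The current law with two ports -/

section TwoPorts

variable {V E : Type*} [DecidableEq V] [Fintype E] {K : Type*} [Field K]
  (G : PortedGraph V (Fin 2) E)

theorem incidence_mulVec_elim (i : Fin 2 → K) (y : E → K) (u : V) :
    (G.incidence K).mulVec (Sum.elim i y) u =
      G.incidence K u (Sum.inl 0) * i 0 + G.incidence K u (Sum.inl 1) * i 1 +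
        ∑ e, G.incidence K u (Sum.inr e) * y e := by
  simp [Matrix.mulVec, dotProduct, Fin.sum_univ_two]

theorem incidence_mulVec_potential (g : E → K) (a b : V) (i : Fin 2 → K) (k : K) (u : V) :
    (G.incidence K).mulVec (Sum.elim i fun e => g e * (k *
        (G.potential g a b (G.tail (Sum.inr e)) - G.potential g a b (G.head (Sum.inr e))))) u =
      G.incidence K u (Sum.inl 0) * i 0 + G.incidence K u (Sum.inl 1) * i 1 +
        k * ((∑ T ∈ G.spanningTrees, ∏ e ∈ T, g e) *
          ((if a = u then 1 else 0) - (if b = u then 1 else 0))) := by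
  rw [incidence_mulVec_elim]
  have h := G.sum_incidence_mul_potential g a b u
  simp only [incidence, Matrix.of_apply] at h ⊢
  congr 1
  rw [← h, Finset.mul_sum]
  exact Finset.sum_congr rfl fun e _ => by ring

end TwoPorts

/-! ### Orthogonality of potential differences and cycles -/

section Duality

variable {V P E : Type*} [Fintype V] [DecidableEq V] {K : Type*} [Field K]
  (G : PortedGraph V P E)

theorem vecMul_incidence (φ : V → K) (s : P ⊕ E) :
    Matrix.vecMul φ (G.incidence K) s = φ (G.tail s) - φ (G.head s) := by
  simp [Matrix.vecMul, dotProduct, incidence, mul_sub]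

/-- Tellegen's theorem: potential differences are orthogonal to the cycle space. -/
theorem dotProduct_potential_difference [Fintype P] [Fintype E] (φ : V → K) (c : P ⊕ E → K) :
    c ⬝ᵥ (fun s => φ (G.tail s) - φ (G.head s)) = φ ⬝ᵥ (G.incidence K).mulVec c := by
  rw [Matrix.dotProduct_mulVec, dotProduct_comm]
  congr 1
  ext s
  rw [vecMul_incidence]

end Duality

end PortedGraph

open PortedGraph in
theorem mainTheorem7 {V E : Type*} [Fintype V] [DecidableEq V] [Fintype E] {K : Type*} [Field K]
    (G : PortedGraph V (Fin 2) E) (g : E → K) (a b c d : V)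
    (ha : G.tail (Sum.inl 0) = a) (hb : G.head (Sum.inl 0) = b)
    (hc : G.tail (Sum.inl 1) = c) (hd : G.head (Sum.inl 1) = d)
    (hg : ∑ T ∈ G.spanningTrees, ∏ e ∈ T, g e ≠ 0) :
    G.HasTransferResistance g (fun _ => 1)
      ((∑ F ∈ G.separatingForests a c b d, ∏ e ∈ F, g e -
          ∑ F ∈ G.separatingForests a d b c, ∏ e ∈ F, g e) /
        ∑ T ∈ G.spanningTrees, ∏ e ∈ T, g e) := by
  have hinc0 : ∀ u, G.incidence K u (Sum.inl 0) =
      (if a = u then 1 else 0) - (if b = u then 1 else 0) := fun u => by simp [incidence, ha, hb]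
  have hinc1 : ∀ u, G.incidence K u (Sum.inl 1) =
      (if c = u then 1 else 0) - (if d = u then 1 else 0) := fun u => by simp [incidence, hc, hd]
  have hpot := G.potential_sub_potential_eq_separatingForests g a b c d
  set S := ∑ T ∈ G.spanningTrees, ∏ e ∈ T, g e with hS
  constructor
  · intro i _ hi1
    -- The sign is negative because the current `i 0` entering the port at `a` has to return through
    -- the resistors from `b` to `a`.
    let φ : V → K := fun w => -(i 0 / S) * G.potential g a b w
    refine ⟨fun p => φ (G.tail (Sum.inl p)) - φ (G.head (Sum.inl p)),
      fun e => -(i 0 / S) *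
        (G.potential g a b (G.tail (Sum.inr e)) - G.potential g a b (G.head (Sum.inr e))),
      ⟨?_, ?_⟩⟩
    · ext u
      rw [incidence_mulVec_potential, hinc0, hi1, ← hS, Pi.zero_apply]
      field_simp
      ring
    · intro z hz
      have h := G.dotProduct_potential_difference φ z
      rw [hz, dotProduct_zero] at h
      rw [← h]
      congr 1
      ext s
      cases s <;> simp [φ, mul_sub]
  · rintro i v ⟨x, hcur, hvol⟩ hi0 hi1
    -- Test cycle: the resistors carry `S` from `c` to `d`, and the second port returns it as `-S`.
    -- The factor `1` only matches the scale `k` in `incidence_mulVec_potential`.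
    have hcyc := hvol (Sum.elim ![0, -S] fun e => g e * (1 *
        (G.potential g c d (G.tail (Sum.inr e)) - G.potential g c d (G.head (Sum.inr e))))) (by
      ext u
      rw [incidence_mulVec_potential, hinc1, ← hS]
      simp
      ring)
    have htel := G.dotProduct_potential_difference (G.potential g c d)
      (Sum.elim i fun e => g e * x e)
    rw [hcur, dotProduct_zero] at htel
    simp only [dotProduct, Fintype.sum_sum_type, Sum.elim_inl, Sum.elim_inr, Fin.sum_univ_two,
      Matrix.cons_val_zero, Matrix.cons_val_one, ha, hb, hi1, zero_mul, one_mul, add_zero,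
      zero_add] at hcyc htel
    have hsum : ∑ e, g e * (G.potential g c d (G.tail (Sum.inr e)) -
        G.potential g c d (G.head (Sum.inr e))) * x e =
        ∑ e, g e * x e * (G.potential g c d (G.tail (Sum.inr e)) -
        G.potential g c d (G.head (Sum.inr e))) :=
      Finset.sum_congr rfl fun e _ => by ring
    rw [hsum] at hcyc
    rw [← hpot, div_eq_div_iff hi0 hg]
    -- Both identities contain the same sum over the resistors, so it cancels and the unknown `x`
    -- disappears.
    linear_combination hcyc - htel
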